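/- Let $\mathcal H$ be a complex Hilbert space, $\mathcal S\subseteq\mathcal H$ a nonzero closed subspace with orthogonal projection $P_{\mathcal S}$, and $A$ a positive (semidefinite) bounded linear operator on $\mathcal H$. For a positive bounded operator $B$ let $$\Sigma(\mathcal S,B)=\max\{X\ge 0:\ X\le B,\ R(X)\subseteq\mathcal S\}$$ be the shorted operator of $B$ to $\mathcal S$ (maximum in the usual order of positive operators; $R(X)$ denotes the range of $X$), and let $$\rho(\mathcal S,A)=\inf_{t\ge 1}\Sigma(\mathcal S,A^t)^{1/t}=\lim_{t\to\infty}\Sigma(\mathcal S,A^t)^{1/t}$$ be the spectral shorted operator, where the limit is in the strong operator topology. For a Borel set $\Delta\subseteq\mathbb R$ let $\chi_\Delta(A)$ be the spectral projection of $A$ on $\Delta$, and let $\sigma$ denote the spectrum. Regard $\rho(\mathcal S,A)$, whose range lies in $\mathcal S$, as an operator on $\mathcal S$. Then all of the following minima and the maximum exist, and $$\begin{aligned}\min\sigma(\rho(\mathcal S,A))&=\max\{\lambda\ge 0:\ P_{\mathcal S}\le\chi_{[\lambda,\infty)}(A)\}\\&=\min\{\mu\in\sigma(A):\ R(\chi_{[\mu,\mu+\varepsilon)}(A))\not\subseteq\mathcal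 S^\perp\ \text{ for all }\varepsilon>0\}\\&=\min\{\mu\in\sigma(A):\ P_{\mathcal S}\,\chi_{[\mu,\mu+\varepsilon)}(A)\ne 0\ \text{ for all }\varepsilon>0\}.\end{aligned}$$ -/

import Mathlib

namespace SpectralShorted

open Filter Topology MeasureTheory
open scoped InnerProductSpace ComplexOrder

variable {H : Type*} [NormedAddCommGroup H] [InnerProductSpace ℂ H] [CompleteSpace H]

/-- In the Loewner order, `X ≤ Y` only depends on the quadratic forms of self-adjoint operators. -/
theorem le_of_re_inner_le {X Y : H →L[ℂ] H} (hX : IsSelfAdjoint X) (hY : IsSelfAdjoint Y)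
    (h : ∀ x, (⟪X x, x⟫_ℂ).re ≤ (⟪Y x, x⟫_ℂ).re) : X ≤ Y := by
  rw [ContinuousLinearMap.le_def, ContinuousLinearMap.isPositive_def']
  refine ⟨hY.sub hX, fun x => ?_⟩
  have := h x
  simp only [ContinuousLinearMap.reApplyInnerSelf_apply, sub_apply,
    inner_sub_left, map_sub, RCLike.re_to_complex]
  linarith

theorem re_inner_le_of_le {H : Type*} [NormedAddCommGroup H] [InnerProductSpace ℂ H]
    {X Y : H →L[ℂ] H} (h : X ≤ Y) (x : H) :
    (⟪X x, x⟫_ℂ).re ≤ (⟪Y x, x⟫_ℂ).re := by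
  have := (ContinuousLinearMap.le_def X Y).1 h |>.re_inner_nonneg_left x
  simp only [sub_apply, inner_sub_left, map_sub, RCLike.re_to_complex] at this
  linarith

/-- For `D ≥ 0` one has `‖D x‖² ≤ ‖D‖ ⟪D x, x⟫`. -/
theorem norm_sq_le {D : H →L[ℂ] H} (hD : 0 ≤ D) (x : H) :
    ‖D x‖ ^ 2 ≤ ‖D‖ * (⟪D x, x⟫_ℂ).re := by
  set R := CFC.sqrt D with hR
  have hRs : IsSelfAdjoint R := IsSelfAdjoint.of_nonneg (CFC.sqrt_nonneg D)
  have hRR : R * R = D := CFC.sqrt_mul_sqrt_self D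
  have h1 : ‖R‖ * ‖R‖ = ‖D‖ := by
    rw [← hRR, ← CStarRing.norm_star_mul_self, hRs.star_eq]
  have hsym := ContinuousLinearMap.isSelfAdjoint_iff_isSymmetric.1 hRs
  have h2 : (⟪D x, x⟫_ℂ).re = ‖R x‖ ^ 2 := by
    rw [← hRR]
    have : ⟪R (R x), x⟫_ℂ = ⟪R x, R x⟫_ℂ := hsym (R x) x
    simp only [mul_apply_eq_comp, this]
    exact inner_self_eq_norm_sq (𝕜 := ℂ) (R x)
  have h3 : ‖D x‖ ≤ ‖R‖ * ‖R x‖ := by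
    rw [← hRR]; exact R.le_opNorm _
  rw [h2, ← h1]
  calc ‖D x‖ ^ 2 ≤ (‖R‖ * ‖R x‖) ^ 2 := by gcongr
    _ = _ := by ring

/-- A decreasing net of positive operators converges strongly to its infimum. -/
theorem exists_strong_limit {ι : Type*} [Preorder ι] [IsDirectedOrder ι] [Nonempty ι]
    (T : ι → H →L[ℂ] H) (hT : Antitone T) (h0 : ∀ i, 0 ≤ T i) :
    ∃ R : H →L[ℂ] H, 0 ≤ R ∧ IsGLB (Set.range T) R ∧
      ∀ x, Tendsto (fun i => T i x) atTop (𝓝 (R x)) := by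
  obtain ⟨i0⟩ := ‹Nonempty ι›
  have : Nonempty ι := ⟨i0⟩
  have hconv : ∀ x, ∃ y, Tendsto (fun i => T i x) atTop (𝓝 y) := by
    intro x
    have hq : Antitone (fun i => (⟪T i x, x⟫_ℂ).re) := fun i j hij => re_inner_le_of_le (hT hij) x
    have hb : BddBelow (Set.range (fun i => (⟪T i x, x⟫_ℂ).re)) := by
      refine ⟨0, ?_⟩
      rintro _ ⟨i, rfl⟩
      simpa using re_inner_le_of_le (h0 i) x
    have hlim := tendsto_atTop_ciInf hq hb
    have hc : Cauchy (map (fun i => T i x) atTop) := by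
      rw [Metric.cauchy_iff]
      refine ⟨inferInstance, fun ε hε => ?_⟩
      set m := ⨅ i, (⟪T i x, x⟫_ℂ).re
      set M := ‖T i0‖ + 1
      have hM : 0 < M := by positivity
      have hδ : 0 < (ε / 3) ^ 2 / M := by positivity
      obtain ⟨i1, hi1⟩ := (hlim.eventually (gt_mem_nhds (lt_add_of_pos_right m hδ))).exists
      obtain ⟨i2, hi20, hi21⟩ := exists_ge_ge i0 i1
      have key : ∀ j, i2 ≤ j → ‖T i2 x - T j x‖ ≤ ε / 3 := by
        intro j hj
        have hD : 0 ≤ T i2 - T j := sub_nonneg.2 (hT hj)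
        have h1 := norm_sq_le hD x
        have h2 : ‖T i2 - T j‖ ≤ M := by
          have h3 : ‖T i2 - T j‖ ≤ ‖T i0‖ :=
            CStarAlgebra.norm_le_norm_of_nonneg_of_le hD
              ((sub_le_self _ (h0 j)).trans (hT hi20))
          simp only [M]; linarith
        have h4 : (⟪(T i2 - T j) x, x⟫_ℂ).re ≤ (ε / 3) ^ 2 / M := by
          have h5 : (⟪T i2 x, x⟫_ℂ).re ≤ (⟪T i1 x, x⟫_ℂ).re := hq hi21
          have h6 : m ≤ (⟪T j x, x⟫_ℂ).re := ciInf_le hb j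
          simp only [sub_apply, inner_sub_left, Complex.sub_re]
          linarith
        have h7 : 0 ≤ (⟪(T i2 - T j) x, x⟫_ℂ).re := by
          simpa using re_inner_le_of_le hD x
        have h8 : ‖(T i2 - T j) x‖ ^ 2 ≤ (ε / 3) ^ 2 := by
          calc _ ≤ _ := h1
            _ ≤ M * ((ε / 3) ^ 2 / M) := by gcongr
            _ = _ := by field_simp
        exact abs_le_of_sq_le_sq' h8 (by positivity) |>.2
      refine ⟨(fun i => T i x) '' Set.Ici i2, image_mem_map (Ici_mem_atTop i2), ?_⟩
      rintro _ ⟨j, hj, rfl⟩ _ ⟨k, hk, rfl⟩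
      have ha := key j hj
      have hb := key k hk
      rw [dist_eq_norm]
      calc ‖T j x - T k x‖ = ‖(T i2 x - T k x) - (T i2 x - T j x)‖ := by congr 1; abel
        _ ≤ ‖T i2 x - T k x‖ + ‖T i2 x - T j x‖ := norm_sub_le _ _
        _ < ε := by linarith
    exact CompleteSpace.complete hc
  choose r hr using hconv
  have hbound : ∀ x, ‖r x‖ ≤ ‖T i0‖ * ‖x‖ := by
    intro x
    refine le_of_tendsto (hr x).norm ?_
    filter_upwards [Ici_mem_atTop i0] with i hi
    refine (T i).le_of_opNorm_le ?_ x
    exact CStarAlgebra.norm_le_norm_of_nonneg_of_le (h0 i) (hT hi)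
  let R : H →L[ℂ] H := LinearMap.mkContinuous
    { toFun := r
      map_add' := fun x y => by
        refine tendsto_nhds_unique (hr (x + y)) ?_
        simpa only [map_add] using (hr x).add (hr y)
      map_smul' := fun c x => by
        refine tendsto_nhds_unique (hr (c • x)) ?_
        simpa only [map_smul, RingHom.id_apply] using (hr x).const_smul c } ‖T i0‖ hbound
  have hR : ∀ x, Tendsto (fun i => T i x) atTop (𝓝 (R x)) := hr
  have hRq : ∀ x, Tendsto (fun i => ⟪T i x, x⟫_ℂ) atTop (𝓝 ⟪R x, x⟫_ℂ) :=
    fun x => (hR x).inner tendsto_const_nhds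
  have hRp : 0 ≤ R := by
    rw [ContinuousLinearMap.nonneg_iff_isPositive, ContinuousLinearMap.isPositive_iff_complex]
    intro x
    have h1 : ∀ i, 0 ≤ ⟪T i x, x⟫_ℂ := fun i =>
      ((ContinuousLinearMap.nonneg_iff_isPositive _).1 (h0 i)).inner_nonneg_left x
    have h2 : 0 ≤ ⟪R x, x⟫_ℂ := ge_of_tendsto' (hRq x) h1
    have h3 := Complex.nonneg_iff.1 h2
    exact ⟨Complex.ext (by simp) (by simpa using h3.2), h3.1⟩
  have hRre : ∀ x, Tendsto (fun i => (⟪T i x, x⟫_ℂ).re) atTop (𝓝 (⟪R x, x⟫_ℂ).re) :=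
    fun x => (Complex.continuous_re.tendsto _).comp (hRq x)
  refine ⟨R, hRp, ⟨?_, ?_⟩, hR⟩
  · rintro _ ⟨i, rfl⟩
    refine le_of_re_inner_le (.of_nonneg hRp) (.of_nonneg (h0 i)) fun x => ?_
    refine le_of_tendsto (hRre x) ?_
    filter_upwards [Ici_mem_atTop i] with j hj
    exact re_inner_le_of_le (hT hj) x
  · intro B hB
    have hBs : IsSelfAdjoint B := by
      have h1 : IsSelfAdjoint (T i0 - B) :=
        .of_nonneg (sub_nonneg.2 (hB ⟨i0, rfl⟩))
      have h2 := (IsSelfAdjoint.of_nonneg (h0 i0)).sub h1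
      simpa using h2
    refine le_of_re_inner_le hBs (.of_nonneg hRp) fun x => ?_
    exact ge_of_tendsto' (hRre x) fun i => re_inner_le_of_le (hB ⟨i, rfl⟩) x


/-- The positive operators `X` with `X ≤ A` and `R(X) ⊆ S`. -/
def shortedSet (S : Submodule ℂ H) (A : H →L[ℂ] H) : Set (H →L[ℂ] H) :=
  {X | 0 ≤ X ∧ X ≤ A ∧ X.range ≤ S}

theorem exists_isGreatest_shortedSet (S : Submodule ℂ H) [CompleteSpace S] (A : H →L[ℂ] H)
    (hA : 0 ≤ A) : ∃ X, IsGreatest (shortedSet S A) X := by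
  set B := CFC.sqrt A with hB
  have hBs : IsSelfAdjoint B := IsSelfAdjoint.of_nonneg (CFC.sqrt_nonneg A)
  have hBB : B * B = A := CFC.sqrt_mul_sqrt_self A
  have hsym : ∀ x y, ⟪B x, y⟫_ℂ = ⟪x, B y⟫_ℂ :=
    ContinuousLinearMap.isSelfAdjoint_iff_isSymmetric.1 hBs
  have hAx : ∀ x, (⟪A x, x⟫_ℂ).re = ‖B x‖ ^ 2 := by
    intro x
    rw [← hBB]
    simp only [mul_apply_eq_comp, hsym (B x) x]
    exact inner_self_eq_norm_sq (𝕜 := ℂ) (B x)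
  -- `N = closure of B(Sᗮ)`, whose orthogonal complement is `B⁻¹(S)`.
  set N : Submodule ℂ H := (Sᗮ.map B.toLinearMap).topologicalClosure with hN
  have hNc : CompleteSpace N := (Submodule.isClosed_topologicalClosure _).completeSpace_coe
  set P : H →L[ℂ] H := Nᗮ.starProjection with hP
  have hPs : ∀ x y, ⟪P x, y⟫_ℂ = ⟪x, P y⟫_ℂ := Submodule.inner_starProjection_left_eq_right Nᗮ
  have hPP : ∀ x, P (P x) = P x := fun x =>
    Submodule.starProjection_eq_self_iff.2 (Submodule.starProjection_apply_mem _ x)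
  have hXs : IsSelfAdjoint (B * P * B) := by
    rw [ContinuousLinearMap.isSelfAdjoint_iff_isSymmetric]
    intro x y
    change ⟪B (P (B x)), y⟫_ℂ = ⟪x, B (P (B y))⟫_ℂ
    rw [hsym, hPs, hsym]
  have hXx : ∀ x, (⟪(B * P * B) x, x⟫_ℂ).re = ‖P (B x)‖ ^ 2 := by
    intro x
    change (⟪B (P (B x)), x⟫_ℂ).re = _
    rw [hsym, ← hPP (B x), hPs, hPP]
    exact inner_self_eq_norm_sq (𝕜 := ℂ) (P (B x))
  refine ⟨B * P * B, ⟨?_, ?_, ?_⟩, ?_⟩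
  · refine le_of_re_inner_le (.zero _) hXs fun x => ?_
    rw [hXx]; simp
  · refine le_of_re_inner_le hXs (.of_nonneg hA) fun x => ?_
    rw [hXx, hAx]
    gcongr
    exact Submodule.norm_starProjection_apply_le _ _
  · rintro _ ⟨x, rfl⟩
    change B (P (B x)) ∈ S
    rw [← Submodule.orthogonal_orthogonal S, Submodule.mem_orthogonal]
    intro u hu
    rw [← hsym]
    have h1 : P (B x) ∈ Nᗮ := Submodule.starProjection_apply_mem _ _
    exact (Submodule.mem_orthogonal _ _).1 h1 _
      (Submodule.le_topologicalClosure _ ⟨u, hu, rfl⟩)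
  · rintro Y ⟨hY0, hYA, hYS⟩
    have hYs : IsSelfAdjoint Y := .of_nonneg hY0
    have hYsym : ∀ x y, ⟪Y x, y⟫_ℂ = ⟪x, Y y⟫_ℂ :=
      ContinuousLinearMap.isSelfAdjoint_iff_isSymmetric.1 hYs
    refine le_of_re_inner_le hYs hXs fun x => ?_
    rw [hXx]
    have hY0' : ∀ y ∈ Sᗮ, Y y = 0 := by
      intro y hy
      rw [← inner_self_eq_zero (𝕜 := ℂ), hYsym]
      exact Submodule.inner_left_of_mem_orthogonal (hYS ⟨_, rfl⟩) hy
    have h1 : ∀ y ∈ Sᗮ, (⟪Y x, x⟫_ℂ).re ≤ ‖B x - B y‖ ^ 2 := by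
      intro y hy
      have h2 := re_inner_le_of_le hYA (x - y)
      rw [hAx, map_sub, map_sub, hY0' y hy, sub_zero, inner_sub_right, hYsym x y, hY0' y hy,
        inner_zero_right, sub_zero] at h2
      exact h2
    have h3 : ∀ z ∈ N, (⟪Y x, x⟫_ℂ).re ≤ ‖B x - z‖ ^ 2 := by
      intro z hz
      have hcl : IsClosed {z : H | (⟪Y x, x⟫_ℂ).re ≤ ‖B x - z‖ ^ 2} :=
        isClosed_le continuous_const (by fun_prop)
      refine closure_minimal ?_ hcl hz
      rintro _ ⟨y, hy, rfl⟩
      exact h1 y hy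
    have h4 := h3 (N.starProjection (B x)) (Submodule.starProjection_apply_mem _ _)
    rwa [hP, Submodule.starProjection_orthogonal_val]

open Classical in
/-- The shorted operator `Σ(S, A) = max {X ≥ 0 : X ≤ A, R(X) ⊆ S}`, the maximum being taken in the
Loewner order. For `A ≥ 0` and `S` closed it exists by `exists_isGreatest_shortedSet`, and being the
greatest element of a set in a partial order it is unique. -/
noncomputable def shorted (S : Submodule ℂ H) (A : H →L[ℂ] H) : H →L[ℂ] H :=
  if h : ∃ X, IsGreatest (shortedSet S A) X then h.choose else 0

theorem shorted_isGreatest (S : Submodule ℂ H) [CompleteSpace S] (A : H →L[ℂ] H) (hA : 0 ≤ A) :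
    IsGreatest (shortedSet S A) (shorted S A) := by
  have h := exists_isGreatest_shortedSet S A hA
  rw [shorted, dif_pos h]
  exact h.choose_spec

/-- `R` is both the infimum of the operators `Σ(S, A ^ t) ^ (1 / t)`, `t ≥ 1`, and their limit in
the strong operator topology as `t → ∞`. -/
def IsSpectralShorted (S : Submodule ℂ H) (A R : H →L[ℂ] H) : Prop :=
  IsGLB ((fun t : ℝ => shorted S (A ^ t) ^ (1 / t)) '' Set.Ici 1) R ∧
    ∀ x, Tendsto (fun t : ℝ => (shorted S (A ^ t) ^ (1 / t)) x) atTop (𝓝 (R x))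

theorem range_le_of_nonneg_of_le {S : Submodule ℂ H} [CompleteSpace S] {X Y : H →L[ℂ] H}
    (hX : 0 ≤ X) (hXY : X ≤ Y) (hY : Y.range ≤ S) : X.range ≤ S := by
  have hYsym : ∀ x y, ⟪Y x, y⟫_ℂ = ⟪x, Y y⟫_ℂ :=
    ContinuousLinearMap.isSelfAdjoint_iff_isSymmetric.1 (.of_nonneg (hX.trans hXY))
  have hXsym : ∀ x y, ⟪X x, y⟫_ℂ = ⟪x, X y⟫_ℂ :=
    ContinuousLinearMap.isSelfAdjoint_iff_isSymmetric.1 (.of_nonneg hX)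
  rintro _ ⟨x, rfl⟩
  change X x ∈ S
  rw [← Submodule.orthogonal_orthogonal S, Submodule.mem_orthogonal]
  intro u hu
  have h1 : (⟪Y u, u⟫_ℂ) = 0 := Submodule.inner_right_of_mem_orthogonal (hY ⟨_, rfl⟩) hu
  have h2 := re_inner_le_of_le hXY u
  have h3 := norm_sq_le hX u
  rw [h1, Complex.zero_re] at h2
  have h4 : ‖X u‖ ^ 2 ≤ 0 := h3.trans (mul_nonpos_of_nonneg_of_nonpos (norm_nonneg _) h2)
  have h5 : X u = 0 := by
    rw [← norm_eq_zero]; exact pow_eq_zero_iff two_ne_zero |>.1 (le_antisymm h4 (by positivity))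
  rw [← hXsym, h5, inner_zero_left]

/-- Roots of operators with range in `S` have range in `S`. -/
theorem range_rpow_le {S : Submodule ℂ H} [CompleteSpace S] {X : H →L[ℂ] H}
    (hX : 0 ≤ X) (hXS : X.range ≤ S) {p : ℝ} (hp : 0 < p) : (X ^ p).range ≤ S := by
  have hXsym : ∀ x y, ⟪X x, y⟫_ℂ = ⟪x, X y⟫_ℂ :=
    ContinuousLinearMap.isSelfAdjoint_iff_isSymmetric.1 (.of_nonneg hX)
  have hYsym : ∀ x y, ⟪(X ^ p) x, y⟫_ℂ = ⟪x, (X ^ p) y⟫_ℂ :=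
    ContinuousLinearMap.isSelfAdjoint_iff_isSymmetric.1 (.of_nonneg CFC.rpow_nonneg)
  have hsqrt : ∀ (Z : H →L[ℂ] H) (u : H), 0 ≤ Z → Z u = 0 → CFC.sqrt Z u = 0 := by
    intro Z u hZ hu
    have hs : ∀ x y, ⟪CFC.sqrt Z x, y⟫_ℂ = ⟪x, CFC.sqrt Z y⟫_ℂ :=
      ContinuousLinearMap.isSelfAdjoint_iff_isSymmetric.1 (.of_nonneg (CFC.sqrt_nonneg Z))
    have h1 : CFC.sqrt Z (CFC.sqrt Z u) = 0 := by
      rw [← mul_apply_eq_comp, CFC.sqrt_mul_sqrt_self Z, hu]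
    rw [← inner_self_eq_zero (𝕜 := ℂ), hs, h1, inner_zero_right]
  have hroot : ∀ (u : H), X u = 0 → ∀ n : ℕ, (X ^ ((1 / 2 : NNReal) ^ n)) u = 0 := by
    intro u hu n
    induction n with
    | zero => rw [pow_zero, CFC.nnrpow_one X hX, hu]
    | succ n ih =>
      have h1 := hsqrt _ u CFC.nnrpow_nonneg ih
      rw [CFC.sqrt_nnrpow] at h1
      rwa [pow_succ, mul_one_div]
  rintro _ ⟨x, rfl⟩
  change (X ^ p) x ∈ S
  rw [← Submodule.orthogonal_orthogonal S, Submodule.mem_orthogonal]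
  intro u hu
  have hu0 : X u = 0 := by
    rw [← inner_self_eq_zero (𝕜 := ℂ), hXsym]
    exact Submodule.inner_left_of_mem_orthogonal (hXS ⟨_, rfl⟩) hu
  lift p to NNReal using hp.le
  have hp' : 0 < p := by exact_mod_cast hp
  obtain ⟨n, hn⟩ := exists_pow_lt_of_lt_one hp' (show (1 / 2 : NNReal) < 1 from NNReal.half_lt_self one_ne_zero)
  have h2 : X ^ p = X ^ (p - (1 / 2 : NNReal) ^ n) * X ^ ((1 / 2 : NNReal) ^ n) := by
    rw [← CFC.nnrpow_add (tsub_pos_of_lt hn) (by positivity), tsub_add_cancel_of_le hn.le]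
  have h3 : (X ^ (p : ℝ)) u = 0 := by
    rw [← CFC.nnrpow_eq_rpow hp', h2, mul_apply_eq_comp, hroot u hu0 n, map_zero]
  rw [← hYsym, h3, inner_zero_left]

/-- The family `t ↦ Σ(S, A ^ t) ^ (1 / t)` is non-increasing on `[1, ∞)`. -/
theorem antitoneOn_shorted_rpow (S : Submodule ℂ H) [CompleteSpace S] (A : H →L[ℂ] H)
    (hA : 0 ≤ A) :
    AntitoneOn (fun t : ℝ => shorted S (A ^ t) ^ (1 / t)) (Set.Ici 1) := by
  intro r hr s hs hrs
  have hr0 : (0 : ℝ) < r := lt_of_lt_of_le one_pos hr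
  have hs0 : (0 : ℝ) < s := lt_of_lt_of_le one_pos hs
  obtain ⟨⟨h0, hle, hran⟩, -⟩ := shorted_isGreatest S (A ^ s) CFC.rpow_nonneg
  have hmax := (shorted_isGreatest S (A ^ r) CFC.rpow_nonneg).2
  have h1 : shorted S (A ^ s) ^ (r / s) ≤ shorted S (A ^ r) := by
    refine hmax ⟨CFC.rpow_nonneg, ?_, range_rpow_le h0 hran (by positivity)⟩
    have h2 := CFC.rpow_le_rpow (p := r / s) ⟨by positivity, (div_le_one hs0).2 hrs⟩ hle
    rwa [CFC.rpow_rpow_of_exponent_nonneg A s (r / s) hs0.le (by positivity) hA,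
      mul_div_cancel₀ _ hs0.ne'] at h2
  have h3 := CFC.rpow_le_rpow (p := 1 / r) ⟨by positivity, (div_le_one hr0).2 hr⟩ h1
  rw [CFC.rpow_rpow_of_exponent_nonneg _ (r / s) (1 / r) (by positivity) (by positivity) h0] at h3
  have h4 : r / s * (1 / r) = 1 / s := by field_simp
  rwa [h4] at h3

theorem exists_isSpectralShorted (S : Submodule ℂ H) [CompleteSpace S] (A : H →L[ℂ] H)
    (hA : 0 ≤ A) : ∃ R, IsSpectralShorted S A R := by
  have han := antitoneOn_shorted_rpow S A hA
  obtain ⟨R, -, hR, hlim⟩ := exists_strong_limit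
    (fun t : Set.Ici (1 : ℝ) => shorted S (A ^ (t : ℝ)) ^ (1 / (t : ℝ)))
    (fun r s h => han r.2 s.2 h) (fun _ => CFC.rpow_nonneg)
  refine ⟨R, ?_, fun x => ?_⟩
  · convert hR using 1
    ext X
    simp
  · have := (tendsto_comp_val_Ici_atTop (a := (1 : ℝ))
      (f := fun t : ℝ => (shorted S (A ^ t) ^ (1 / t)) x) (l := 𝓝 (R x))).1 (hlim x)
    exact this

open Classical in
/-- The spectral shorted operator
`ρ(S, A) = inf_{t ≥ 1} Σ(S, A ^ t) ^ (1 / t) = lim_{t → ∞} Σ(S, A ^ t) ^ (1 / t)` (strong limit).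
For `A ≥ 0` and `S` closed it exists by `exists_isSpectralShorted`. -/
noncomputable def spectralShorted (S : Submodule ℂ H) (A : H →L[ℂ] H) : H →L[ℂ] H :=
  if h : ∃ R, IsSpectralShorted S A R then h.choose else 0

theorem spectralShorted_spec (S : Submodule ℂ H) [CompleteSpace S] (A : H →L[ℂ] H)
    (hA : 0 ≤ A) : IsSpectralShorted S A (spectralShorted S A) := by
  have h := exists_isSpectralShorted S A hA
  rw [spectralShorted, dif_pos h]
  exact h.choose_spec


theorem range_spectralShorted_le (S : Submodule ℂ H) [CompleteSpace S] (A : H →L[ℂ] H)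
    (hA : 0 ≤ A) : (spectralShorted S A).range ≤ S := by
  obtain ⟨⟨hlb, hgr⟩, -⟩ := spectralShorted_spec S A hA
  have h0 : 0 ≤ spectralShorted S A := by
    apply hgr
    rintro _ ⟨t, -, rfl⟩
    exact CFC.rpow_nonneg
  have h1 : spectralShorted S A ≤ shorted S A := by
    have h2 := hlb ⟨1, Set.self_mem_Ici, rfl⟩
    obtain ⟨⟨h3, -⟩, -⟩ := shorted_isGreatest S A hA
    simpa [CFC.rpow_one A hA, CFC.rpow_one (shorted S A) h3] using h2
  exact range_le_of_nonneg_of_le h0 h1 (shorted_isGreatest S A hA).1.2.2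

/-- The compression of `T` to `S`, that is, `T` considered as acting on `S`. -/
noncomputable def compression {H : Type*} [NormedAddCommGroup H] [InnerProductSpace ℂ H]
    (S : Submodule ℂ H) [CompleteSpace S] (T : H →L[ℂ] H) : S →L[ℂ] S :=
  S.orthogonalProjectionOnto ∘L T ∘L S.subtypeL

theorem coe_compression {H : Type*} [NormedAddCommGroup H] [InnerProductSpace ℂ H]
    (S : Submodule ℂ H) [CompleteSpace S] {T : H →L[ℂ] H}
    (hT : T.range ≤ S) (x : S) : (compression S T x : H) = T x := by
  have h : T x ∈ S := hT ⟨_, rfl⟩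
  exact Submodule.starProjection_eq_self_iff.2 h

/-- `μ` is the scalar spectral measure of `A` at `x`: `∫ f dμ = ⟪f(A) x, x⟫` for every bounded
continuous `f`, where `f(A)` is the continuous functional calculus. -/
def IsSpectralMeasure (A : H →L[ℂ] H) (x : H) (μ : Measure ℝ) : Prop :=
  IsFiniteMeasure μ ∧
    ∀ f : BoundedContinuousFunction ℝ ℝ, ((∫ t, f t ∂μ : ℝ) : ℂ) = ⟪cfc (f : ℝ → ℝ) A x, x⟫_ℂ

theorem IsSpectralMeasure.unique {A : H →L[ℂ] H} {x : H} {μ ν : Measure ℝ}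
    (hμ : IsSpectralMeasure A x μ) (hν : IsSpectralMeasure A x ν) : μ = ν := by
  have := hμ.1
  have := hν.1
  refine ext_of_forall_integral_eq_of_IsFiniteMeasure fun f => ?_
  exact_mod_cast (hμ.2 f).trans (hν.2 f).symm

theorem re_inner_cfc {A : H →L[ℂ] H} (f : ℝ → ℝ) (x : H) :
    (((⟪cfc f A x, x⟫_ℂ).re : ℝ) : ℂ) = ⟪cfc f A x, x⟫_ℂ := by
  have h : IsSelfAdjoint (cfc f A) := cfc_predicate f A
  have hs := ContinuousLinearMap.isSelfAdjoint_iff_isSymmetric.1 h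
  exact hs.coe_re_inner_apply_self x

open scoped CompactlySupported in
theorem exists_isSpectralMeasure {A : H →L[ℂ] H} (hA : IsSelfAdjoint A) (x : H) :
    ∃ μ, IsSpectralMeasure A x μ := by
  let Λ₀ : C_c(spectrum ℝ A, ℝ) →ₗ[ℝ] ℝ :=
    { toFun := fun f => (⟪cfcHom hA (f : C(spectrum ℝ A, ℝ)) x, x⟫_ℂ).re
      map_add' := fun f g => by
        have : ((f + g : C_c(spectrum ℝ A, ℝ)) : C(spectrum ℝ A, ℝ)) = (f : C(spectrum ℝ A, ℝ)) + g := rfl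
        rw [this, map_add]; simp
      map_smul' := fun c f => by
        have : ((c • f : C_c(spectrum ℝ A, ℝ)) : C(spectrum ℝ A, ℝ)) = c • (f : C(spectrum ℝ A, ℝ)) := rfl
        rw [this, map_smul]; simp }
  have hΛ : ∀ f, 0 ≤ f → 0 ≤ Λ₀ f := by
    intro f hf
    have h1 : 0 ≤ cfcHom hA (f : C(spectrum ℝ A, ℝ)) := (cfcHom_nonneg_iff hA).2 (fun t => hf t)
    have h2 := re_inner_le_of_le h1 x
    rw [zero_apply, inner_zero_left, Complex.zero_re] at h2
    exact h2
  let Λ : C_c(spectrum ℝ A, ℝ) →ₚ[ℝ] ℝ := PositiveLinearMap.mk₀ Λ₀ hΛ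
  have : CompactSpace (spectrum ℝ A) := isCompact_iff_compactSpace.1 (spectrum.isCompact A)
  set ν := RealRMK.rieszMeasure Λ with hν
  have : IsFiniteMeasure ν := inferInstance
  refine ⟨ν.map Subtype.val, inferInstance, fun f => ?_⟩
  rw [integral_map (by fun_prop) (f.continuous.aestronglyMeasurable)]
  have h1 := RealRMK.integral_rieszMeasure Λ
    (CompactlySupportedContinuousMap.continuousMapEquiv
      ⟨(spectrum ℝ A).domRestrict f, f.continuous.continuousOn.domRestrict⟩)
  rw [← re_inner_cfc, cfc_apply f A hA f.continuous.continuousOn]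
  exact congrArg _ h1

open Classical in
/-- The scalar spectral measure of a self-adjoint operator `A` at `x`; it exists by
`exists_isSpectralMeasure` and is unique by `IsSpectralMeasure.unique`. -/
noncomputable def spectralMeasure (A : H →L[ℂ] H) (x : H) : Measure ℝ :=
  if h : ∃ μ, IsSpectralMeasure A x μ then h.choose else 0

theorem spectralMeasure_spec {A : H →L[ℂ] H} (hA : IsSelfAdjoint A) (x : H) :
    IsSpectralMeasure A x (spectralMeasure A x) := by
  have h := exists_isSpectralMeasure hA x
  rw [spectralMeasure, dif_pos h]
  exact h.choose_spec

/-- `E` is the operator `χ_Δ(A)`: its quadratic form at `x` is `μ_{A,x}(Δ)`. -/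
def IsSpectralProjection (A : H →L[ℂ] H) (Δ : Set ℝ) (E : H →L[ℂ] H) : Prop :=
  ∀ x, ⟪E x, x⟫_ℂ = ((spectralMeasure A x).real Δ : ℂ)

theorem IsSpectralProjection.unique {A : H →L[ℂ] H} {Δ : Set ℝ} {E F : H →L[ℂ] H}
    (hE : IsSpectralProjection A Δ E) (hF : IsSpectralProjection A Δ F) : E = F := by
  have : (E : H →ₗ[ℂ] H) = F := (ext_inner_map _ _).1 fun x => (hE x).trans (hF x).symm
  exact_mod_cast this

theorem IsSpectralProjection.nonneg {A : H →L[ℂ] H} {Δ : Set ℝ} {E : H →L[ℂ] H}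
    (hE : IsSpectralProjection A Δ E) : 0 ≤ E := by
  rw [ContinuousLinearMap.nonneg_iff_isPositive, ContinuousLinearMap.isPositive_iff_complex]
  intro x
  rw [hE x]
  simp

theorem spectralMeasure_univ {A : H →L[ℂ] H} (hA : IsSelfAdjoint A) (x : H) :
    (((spectralMeasure A x).real Set.univ : ℝ) : ℂ) = ⟪x, x⟫_ℂ := by
  have h := (spectralMeasure_spec hA x).2 1
  have h1 : cfc (⇑(1 : BoundedContinuousFunction ℝ ℝ)) A = 1 := cfc_one ℝ A
  rw [h1] at h
  simpa using h

theorem isSpectralProjection_compl {A : H →L[ℂ] H} (hA : IsSelfAdjoint A) {Δ : Set ℝ}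
    (hΔ : MeasurableSet Δ) {E : H →L[ℂ] H} (hE : IsSpectralProjection A Δ E) :
    IsSpectralProjection A Δᶜ (1 - E) := by
  intro x
  have := (spectralMeasure_spec hA x).1
  rw [measureReal_compl hΔ, Complex.ofReal_sub, spectralMeasure_univ hA, ← hE x]
  simp

/-- Decreasing continuous approximations of the indicator of `[a, ∞)`. -/
noncomputable def ramp (a : ℝ) (n : ℕ) : BoundedContinuousFunction ℝ ℝ :=
  BoundedContinuousFunction.ofNormedAddCommGroup (fun t => max 0 (min 1 (1 + n * (t - a))))
    (by fun_prop) 1 (fun t => by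
      rw [Real.norm_of_nonneg (le_max_left _ _)]
      exact max_le zero_le_one (min_le_left _ _))

theorem ramp_apply (a : ℝ) (n : ℕ) (t : ℝ) :
    ramp a n t = max 0 (min 1 (1 + n * (t - a))) := rfl

theorem ramp_antitone (a t : ℝ) : Antitone fun n => ramp a n t := by
  intro m n hmn
  have hmn' : (m : ℝ) ≤ n := by exact_mod_cast hmn
  simp only [ramp_apply]
  rcases le_total a t with h | h
  · have h1 : ∀ k : ℕ, min 1 (1 + (k : ℝ) * (t - a)) = 1 := fun k =>
      min_eq_left (by nlinarith [mul_nonneg (Nat.cast_nonneg (α := ℝ) k) (sub_nonneg.2 h)])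
    rw [h1, h1]
  · gcongr max 0 (min 1 ?_)
    nlinarith

theorem ramp_tendsto (a t : ℝ) :
    Tendsto (fun n => ramp a n t) atTop (𝓝 ((Set.Ici a).indicator (fun _ => (1 : ℝ)) t)) := by
  by_cases h : a ≤ t
  · rw [Set.indicator_of_mem (Set.mem_Ici.2 h)]
    refine tendsto_const_nhds.congr fun n => ?_
    rw [ramp_apply, min_eq_left, max_eq_right zero_le_one]
    nlinarith [mul_nonneg (Nat.cast_nonneg (α := ℝ) n) (sub_nonneg.2 h)]
  · rw [Set.indicator_of_notMem (by simpa using h)]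
    push Not at h
    obtain ⟨N, hN⟩ := exists_nat_gt (1 / (a - t))
    refine tendsto_const_nhds.congr' ?_
    filter_upwards [eventually_ge_atTop N] with n hn
    have h1 : (N : ℝ) ≤ n := by exact_mod_cast hn
    have h2 : 1 < (N : ℝ) * (a - t) := (div_lt_iff₀ (by linarith)).1 hN
    rw [ramp_apply, eq_comm]
    refine max_eq_left (min_le_of_right_le ?_)
    nlinarith

theorem exists_isSpectralProjection_Ici {A : H →L[ℂ] H} (hA : IsSelfAdjoint A) (a : ℝ) :
    ∃ E, IsSpectralProjection A (Set.Ici a) E := by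
  obtain ⟨E, -, -, hE⟩ := exists_strong_limit (fun n : ℕ => cfc (⇑(ramp a n)) A)
    (fun m n hmn => cfc_mono (fun t _ => ramp_antitone a t hmn)
      (ramp a n).continuous.continuousOn (ramp a m).continuous.continuousOn)
    (fun n => cfc_nonneg fun t _ => le_max_left _ _)
  refine ⟨E, fun x => ?_⟩
  have hμ := spectralMeasure_spec hA x
  have := hμ.1
  have h1 : Tendsto (fun n : ℕ => ⟪cfc (⇑(ramp a n)) A x, x⟫_ℂ) atTop (𝓝 ⟪E x, x⟫_ℂ) :=
    (hE x).inner tendsto_const_nhds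
  have h2 : Tendsto (fun n : ℕ => ∫ t, ramp a n t ∂(spectralMeasure A x)) atTop
      (𝓝 (∫ t, (Set.Ici a).indicator (fun _ => (1 : ℝ)) t ∂(spectralMeasure A x))) := by
    refine tendsto_integral_of_dominated_convergence (fun _ => 1)
      (fun n => (ramp a n).continuous.aestronglyMeasurable) (integrable_const _)
      (fun n => .of_forall fun t => ?_) (.of_forall fun t => ramp_tendsto a t)
    rw [ramp_apply, Real.norm_of_nonneg (le_max_left _ _)]
    exact max_le zero_le_one (min_le_left _ _)
  rw [integral_indicator_const _ measurableSet_Ici, smul_eq_mul, mul_one] at h2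
  refine tendsto_nhds_unique h1 ?_
  simp_rw [← hμ.2]
  exact (Complex.continuous_ofReal.tendsto _).comp h2

theorem exists_isSpectralProjection {A : H →L[ℂ] H} (hA : IsSelfAdjoint A) {Δ : Set ℝ}
    (hΔ : MeasurableSet Δ) : ∃ E, IsSpectralProjection A Δ E := by
  induction Δ, hΔ using MeasurableSpace.induction_on_inter
    (borel_eq_generateFrom_Ici ℝ ▸ BorelSpace.measurable_eq (α := ℝ)) isPiSystem_Ici with
  | empty => exact ⟨0, fun x => by simp⟩
  | basic t ht =>
    obtain ⟨a, rfl⟩ := ht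
    exact exists_isSpectralProjection_Ici hA a
  | compl t ht ih =>
    obtain ⟨E, hE⟩ := ih
    exact ⟨1 - E, isSpectralProjection_compl hA ht hE⟩
  | iUnion f hd hf ih =>
    choose E hE using ih
    have hsum : ∀ n x, ⟪(∑ i ∈ Finset.range n, E i) x, x⟫_ℂ =
        ((spectralMeasure A x).real (⋃ i ∈ Finset.range n, f i) : ℂ) := by
      intro n x
      have := (spectralMeasure_spec hA x).1
      rw [measureReal_biUnion_finset (fun i _ j _ hij => hd hij) (fun i _ => hf i)]
      simp [hE _ x]
    have hproj : ∀ n, IsSpectralProjection A (⋃ i ∈ Finset.range n, f i)ᶜ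
        (1 - ∑ i ∈ Finset.range n, E i) := fun n =>
      isSpectralProjection_compl hA (.biUnion (Finset.countable_toSet _) fun i _ => hf i) (hsum n)
    obtain ⟨R, -, -, hR⟩ := exists_strong_limit (fun n : ℕ => 1 - ∑ i ∈ Finset.range n, E i)
      (fun m n hmn => sub_le_sub_left (Finset.sum_le_sum_of_subset_of_nonneg
        (Finset.range_mono hmn) fun i _ _ => (hE i).nonneg) 1) (fun n => (hproj n).nonneg)
    refine ⟨1 - R, fun x => ?_⟩
    have hμ := (spectralMeasure_spec hA x).1
    have h1 : Tendsto (fun n : ℕ => ⟪(∑ i ∈ Finset.range n, E i) x, x⟫_ℂ) atTop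
        (𝓝 ⟪(1 - R) x, x⟫_ℂ) := by
      have h2 := (tendsto_const_nhds (x := x)).sub (hR x)
      refine Tendsto.inner (h2.congr fun n => ?_) tendsto_const_nhds
      simp
    refine tendsto_nhds_unique h1 ?_
    simp_rw [hsum]
    refine (Complex.continuous_ofReal.tendsto _).comp ?_
    have h3 : (⋃ i, f i) = ⋃ n : ℕ, ⋃ i ∈ Finset.range n, f i := by
      ext t
      simp only [Set.mem_iUnion, Finset.mem_range]
      exact ⟨fun ⟨i, hi⟩ => ⟨i + 1, i, Nat.lt_succ_self i, hi⟩, fun ⟨_, i, _, hi⟩ => ⟨i, hi⟩⟩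
    rw [h3]
    refine (ENNReal.tendsto_toReal (measure_ne_top _ _)).comp
      (tendsto_measure_iUnion_atTop fun m n hmn => ?_)
    exact Set.biUnion_subset_biUnion_left (Finset.range_mono hmn)

open Classical in
/-- The spectral projection `E_A(Δ) = χ_Δ(A)` of a self-adjoint operator `A`, for `Δ ⊆ ℝ` Borel.
It exists by `exists_isSpectralProjection` and is unique by `IsSpectralProjection.unique`. -/
noncomputable def spectralProjection (A : H →L[ℂ] H) (Δ : Set ℝ) : H →L[ℂ] H :=
  if h : ∃ E, IsSpectralProjection A Δ E then h.choose else 0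

theorem spectralProjection_spec {A : H →L[ℂ] H} (hA : IsSelfAdjoint A) {Δ : Set ℝ}
    (hΔ : MeasurableSet Δ) : IsSpectralProjection A Δ (spectralProjection A Δ) := by
  have h := exists_isSpectralProjection hA hΔ
  rw [spectralProjection, dif_pos h]
  exact h.choose_spec

end SpectralShorted

namespace SpectralShorted

open Filter Topology MeasureTheory
open scoped InnerProductSpace ComplexOrder

/-! Write `P` for the projection onto `S`, `ρ` for the spectral shorted operator and `μ_x` for the
scalar spectral measure of `A` at `x`. Every condition in the theorem concerns null sets of the
`μ_x` with `x ∈ S`: `P ≤ χ_[l,∞)(A)` means that they all vanish on `(-∞, l)`, and `P χ_Δ(A) = 0`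
means that they all vanish on `Δ`. Since the `μ_x` live on the spectrum and are continuous along
increasing unions, a greatest such `l ≥ 0` exists; call it `m`. The two minima over `σ(A)` are then
read off from the maximality of `m`.

The spectral content is that `m` is also the bottom of the spectrum of `ρ` on `S`, that is, the
greatest `c` with `c P ≤ ρ`. On one side, `m ^ t P ≤ m ^ t χ_[m,∞)(A) ≤ A ^ t` makes `m ^ t P` a
competitor for `Σ(S, A ^ t)`, and taking roots gives `m P ≤ ρ`
(`smul_starProjection_le_spectralShorted`). On the other side, `c P ≤ ρ` with `c ≥ 0` gives `c ^ n P
≤ A ^ n` for all `n ≥ 1` (`smul_starProjection_le_pow_of_le_spectralShorted`). If `0 ≤ l < c` and `y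
= f(A) x` with `f` vanishing on `[l, ∞)`, then `c ^ n ‖P y‖² ≤ ⟪A ^ n y, y⟫ ≤ l ^ n b` with `b`
independent of `n`, which forces `P y = 0`. For `x ∈ S` this gives `⟪f(A) x, x⟫ = 0`, so `μ_x`
vanishes on `(-∞, l)` (`spectralMeasure_Iio_eq_zero_of_pow_le`). -/

theorem re_inner_smul_apply {H : Type*} [NormedAddCommGroup H] [InnerProductSpace ℂ H]
    (c : ℝ) (T : H →L[ℂ] H) (x : H) :
    (⟪(c • T) x, x⟫_ℂ).re = c * (⟪T x, x⟫_ℂ).re := by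
  rw [smul_apply, RCLike.real_smul_eq_coe_smul (K := ℂ), inner_smul_left]
  simp

variable {H : Type*} [NormedAddCommGroup H] [InnerProductSpace ℂ H] [CompleteSpace H]

theorem inner_left_eq_right {T : H →L[ℂ] H} (hT : IsSelfAdjoint T) (x y : H) :
    ⟪T x, y⟫_ℂ = ⟪x, T y⟫_ℂ :=
  ContinuousLinearMap.isSelfAdjoint_iff_isSymmetric.1 hT x y

theorem re_inner_starProjection {H : Type*} [NormedAddCommGroup H] [InnerProductSpace ℂ H]
    (S : Submodule ℂ H) [CompleteSpace S] (x : H) :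
    (⟪S.starProjection x, x⟫_ℂ).re = ‖S.starProjection x‖ ^ 2 := by
  have h : S.starProjection (S.starProjection x) = S.starProjection x :=
    Submodule.starProjection_eq_self_iff.2 (Submodule.starProjection_apply_mem _ x)
  rw [← h, Submodule.inner_starProjection_left_eq_right, h]
  exact inner_self_eq_norm_sq (𝕜 := ℂ) _

theorem starProjection_nonneg (S : Submodule ℂ H) [CompleteSpace S] : 0 ≤ S.starProjection :=
  isStarProjection_starProjection.nonneg

/-! ### Null sets of scalar spectral measures -/

theorem spectralMeasure_eq_zero_of_inner_cfc {A : H →L[ℂ] H} (hA : IsSelfAdjoint A) {x : H}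
    (f : BoundedContinuousFunction ℝ ℝ) (hf : 0 ≤ ⇑f) {U : Set ℝ} (hU : ∀ t ∈ U, f t ≠ 0)
    (h : ⟪cfc f A x, x⟫_ℂ = 0) : spectralMeasure A x U = 0 := by
  have hμ := spectralMeasure_spec hA x
  have := hμ.1
  have h1 : ∫ t, f t ∂(spectralMeasure A x) = 0 := by
    have h2 := (hμ.2 f).trans h
    exact_mod_cast h2
  have h3 := (integral_eq_zero_iff_of_nonneg hf (f.integrable _)).1 h1
  exact measure_mono_null (fun t ht => hU t ht) h3

/-- The truncated distance to the spectrum is a test function that is positive off the spectrum and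
zero on it, so its functional calculus vanishes. Nontriviality makes the spectrum nonempty, without
which `Metric.infDist` would be identically zero. -/
theorem spectralMeasure_compl_spectrum [Nontrivial H] {A : H →L[ℂ] H} (hA : IsSelfAdjoint A)
    (x : H) : spectralMeasure A x (spectrum ℝ A)ᶜ = 0 := by
  have hne : (spectrum ℝ A).Nonempty := ContinuousFunctionalCalculus.spectrum_nonempty A hA
  let f : BoundedContinuousFunction ℝ ℝ := BoundedContinuousFunction.ofNormedAddCommGroup
    (fun t => min 1 (Metric.infDist t (spectrum ℝ A))) (by fun_prop) 1 (fun t => by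
      rw [Real.norm_of_nonneg (le_min zero_le_one Metric.infDist_nonneg)]
      exact min_le_left _ _)
  have hf : ∀ t, f t = min 1 (Metric.infDist t (spectrum ℝ A)) := fun _ => rfl
  refine spectralMeasure_eq_zero_of_inner_cfc hA f
    (fun t => le_min zero_le_one Metric.infDist_nonneg) (fun t ht => ?_) ?_
  · have h1 := ((spectrum.isCompact A).isClosed.notMem_iff_infDist_pos hne).1 ht
    exact (lt_min one_pos h1).ne'
  · have h2 : cfc f A = 0 := by
      rw [cfc_congr (g := fun _ => 0) fun t ht => ?_]
      · exact cfc_zero ℝ A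
      · rw [hf, Metric.infDist_zero_of_mem ht, min_eq_right zero_le_one]
    rw [h2, zero_apply, inner_zero_left]

/-- This is what makes the supremum of the admissible `l` a maximum. -/
theorem measure_Iio_eq_zero_of_forall_lt {μ : Measure ℝ} {c : ℝ}
    (h : ∀ l < c, μ (Set.Iio l) = 0) : μ (Set.Iio c) = 0 := by
  obtain ⟨u, -, hu, hlim⟩ := exists_seq_strictMono_tendsto c
  have h1 : Set.Iio c ⊆ ⋃ n, Set.Iio (u n) := fun t ht =>
    Set.mem_iUnion.2 (hlim.eventually (lt_mem_nhds (Set.mem_Iio.1 ht))).exists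
  exact measure_mono_null h1 (measure_iUnion_null fun n => h _ (hu n))

/-! ### Spectral projections and the subspace -/

/-- Positivity of `χ_Δ(A)` suffices, through `‖E x‖² ≤ ‖E‖ ⟪E x, x⟫`; idempotence plays no role. -/
theorem spectralProjection_apply_eq_zero_iff {A : H →L[ℂ] H} (hA : IsSelfAdjoint A) {Δ : Set ℝ}
    (hΔ : MeasurableSet Δ) (x : H) :
    spectralProjection A Δ x = 0 ↔ spectralMeasure A x Δ = 0 := by
  have hE := spectralProjection_spec hA hΔ
  have := (spectralMeasure_spec hA x).1
  rw [← measureReal_eq_zero_iff]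
  constructor
  · intro h
    have h1 := hE x
    rw [h, inner_zero_left] at h1
    exact_mod_cast h1.symm
  · intro h
    have h1 := norm_sq_le hE.nonneg x
    rw [hE x, h] at h1
    simpa using h1

/-- By taking adjoints, `P E = 0` is the same as `E P = 0`, which says that `E` kills `S`. -/
theorem starProjection_mul_spectralProjection_eq_zero_iff (S : Submodule ℂ H) [CompleteSpace S]
    {A : H →L[ℂ] H} (hA : IsSelfAdjoint A) {Δ : Set ℝ} (hΔ : MeasurableSet Δ) :
    S.starProjection * spectralProjection A Δ = 0 ↔ ∀ x ∈ S, spectralMeasure A x Δ = 0 := by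
  set E := spectralProjection A Δ with hE
  have hEs : IsSelfAdjoint E := .of_nonneg (spectralProjection_spec hA hΔ).nonneg
  have hPs : IsSelfAdjoint S.starProjection := .of_nonneg (starProjection_nonneg S)
  have h1 : S.starProjection * E = 0 ↔ E * S.starProjection = 0 := by
    rw [← star_eq_zero (x := S.starProjection * E), star_mul, hEs.star_eq, hPs.star_eq]
  rw [h1]
  simp_rw [← spectralProjection_apply_eq_zero_iff hA hΔ]
  constructor
  · intro h x hx
    have h2 := congrArg (fun T : H →L[ℂ] H => T x) h
    simpa [mul_apply_eq_comp, Submodule.starProjection_eq_self_iff.2 hx] using h2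
  · intro h
    ext x
    exact h _ (Submodule.starProjection_apply_mem S x)

theorem range_le_orthogonal_iff {H : Type*} [NormedAddCommGroup H] [InnerProductSpace ℂ H]
    (S : Submodule ℂ H) [CompleteSpace S] (E : H →L[ℂ] H) :
    E.range ≤ Sᗮ ↔ S.starProjection * E = 0 := by
  constructor
  · intro h
    ext x
    exact (Submodule.starProjection_apply_eq_zero_iff S).2 (h ⟨x, rfl⟩)
  · rintro h _ ⟨x, rfl⟩
    exact (Submodule.starProjection_apply_eq_zero_iff S).1
      (congrArg (fun T : H →L[ℂ] H => T x) h)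

/-- The complement `1 - E` is the spectral operator of `(-∞, l)`, so the right side says that `E`
fixes every vector of `S`. -/
theorem starProjection_le_spectralProjection_iff (S : Submodule ℂ H) [CompleteSpace S]
    {A : H →L[ℂ] H} (hA : IsSelfAdjoint A) (l : ℝ) :
    S.starProjection ≤ spectralProjection A (Set.Ici l) ↔
      ∀ x ∈ S, spectralMeasure A x (Set.Iio l) = 0 := by
  have hE := spectralProjection_spec hA (measurableSet_Ici (a := l))
  have hF := isSpectralProjection_compl hA measurableSet_Ici hE
  rw [Set.compl_Ici] at hF
  set E := spectralProjection A (Set.Ici l)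
  have hEs : IsSelfAdjoint E := .of_nonneg hE.nonneg
  constructor
  · intro h x hx
    have := (spectralMeasure_spec hA x).1
    have h1 := re_inner_le_of_le h x
    have h2 := congrArg Complex.re (hF x)
    rw [Submodule.starProjection_eq_self_iff.2 hx] at h1
    simp only [sub_apply, one_apply_eq_self, inner_sub_left, Complex.sub_re,
      Complex.ofReal_re] at h2
    rw [← measureReal_eq_zero_iff]
    exact le_antisymm (by linarith) measureReal_nonneg
  · intro h
    refine le_of_re_inner_le (.of_nonneg (starProjection_nonneg S)) hEs fun x => ?_
    have h1 : E (S.starProjection x) = S.starProjection x := by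
      have h2 := norm_sq_le hF.nonneg (S.starProjection x)
      have := (spectralMeasure_spec hA (S.starProjection x)).1
      rw [hF, (measureReal_eq_zero_iff).2 (h _ (Submodule.starProjection_apply_mem S x)),
        Complex.ofReal_zero, Complex.zero_re, mul_zero] at h2
      have h3 := norm_eq_zero.1 (pow_eq_zero_iff two_ne_zero |>.1 (le_antisymm h2 (by positivity)))
      rw [sub_apply, sub_eq_zero] at h3
      exact h3.symm
    set p := S.starProjection x with hp
    have h4 : ⟪p, x - p⟫_ℂ = 0 :=
      Submodule.inner_right_of_mem_orthogonal (Submodule.starProjection_apply_mem S x)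
        (Submodule.sub_starProjection_mem_orthogonal x)
    -- Since `E p = p` and `p ⊥ x - p`, this form expands to `⟪E x, x⟫ - ⟪p, x⟫`, the difference to
    -- be shown nonnegative.
    have h5 : 0 ≤ (⟪E (x - p), x - p⟫_ℂ).re := by
      simpa using re_inner_le_of_le hE.nonneg (x - p)
    rw [map_sub, h1, inner_sub_left, h4, sub_zero, inner_sub_right,
      inner_left_eq_right hEs x p, h1, Complex.sub_re] at h5
    have h6 : ⟪x, p⟫_ℂ = ⟪p, x⟫_ℂ :=
      (Submodule.inner_starProjection_left_eq_right S x x).symm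
    rw [h6] at h5
    linarith

/-! ### Lower bounds of the spectral shorted operator -/

theorem smul_spectralProjection_Ici_le_rpow {A : H →L[ℂ] H} (hA : 0 ≤ A) {m s : ℝ} (hm : 0 ≤ m)
    (hs : 0 < s) : m ^ s • spectralProjection A (Set.Ici m) ≤ A ^ s := by
  have hAs : IsSelfAdjoint A := .of_nonneg hA
  have hE := spectralProjection_spec hAs (measurableSet_Ici (a := m))
  have hc : 0 ≤ m ^ s := by positivity
  refine le_of_re_inner_le ((IsSelfAdjoint.all _).smul (.of_nonneg hE.nonneg))
    (.of_nonneg CFC.rpow_nonneg) fun x => ?_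
  have hcont : Continuous fun t : ℝ => (max t 0) ^ s :=
    (continuous_id.max continuous_const).rpow_const fun _ => Or.inr hs.le
  have hnn : ∀ t : ℝ, 0 ≤ min ((max t 0) ^ s) (m ^ s) := fun t =>
    le_min (Real.rpow_nonneg (le_max_right _ _) _) hc
  -- A bounded continuous function between `m ^ s` times the indicator of `[m, ∞)` and, on the
  -- spectrum, `t ^ s`. The truncation at `m ^ s` provides the boundedness required to integrate
  -- against the spectral measure.
  let f : BoundedContinuousFunction ℝ ℝ := BoundedContinuousFunction.ofNormedAddCommGroup
    (fun t => min ((max t 0) ^ s) (m ^ s)) (hcont.min continuous_const) (m ^ s) (fun t => by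
      rw [Real.norm_of_nonneg (hnn t)]
      exact min_le_right _ _)
  have hμ := spectralMeasure_spec hAs x
  have := hμ.1
  have h1 : cfc f A ≤ A ^ s := by
    rw [CFC.rpow_eq_cfc_real hA]
    refine cfc_mono (fun t ht => ?_) f.continuous.continuousOn
      (Real.continuous_rpow_const hs.le).continuousOn
    have ht0 : 0 ≤ t := spectrum_nonneg_of_nonneg hA ht
    have : f t = min ((max t 0) ^ s) (m ^ s) := rfl
    rw [this, max_eq_left ht0]
    exact min_le_left _ _
  have h2 : m ^ s * (spectralMeasure A x).real (Set.Ici m) ≤ ∫ t, f t ∂(spectralMeasure A x) := by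
    rw [mul_comm, ← smul_eq_mul, ← integral_indicator_const _ measurableSet_Ici]
    refine integral_mono ((integrable_const _).indicator measurableSet_Ici) (f.integrable _)
      fun t => ?_
    refine Set.indicator_apply_le' (fun ht => le_min ?_ le_rfl) fun _ => hnn t
    exact Real.rpow_le_rpow hm (le_max_of_le_left ht) hs.le
  rw [re_inner_smul_apply, hE x, Complex.ofReal_re]
  refine h2.trans (le_trans (le_of_eq ?_) (re_inner_le_of_le h1 x))
  rw [← hμ.2 f, Complex.ofReal_re]

theorem smul_starProjection_rpow (S : Submodule ℂ H) [CompleteSpace S] {c s : ℝ} (hc : 0 ≤ c)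
    (hs : 0 < s) : (c • S.starProjection) ^ s = c ^ s • S.starProjection := by
  have hP : IsSelfAdjoint S.starProjection := .of_nonneg (starProjection_nonneg S)
  have h1 : ∀ a : ℝ, cfc (fun t : ℝ => a * t) S.starProjection = a • S.starProjection := fun a => by
    rw [cfc_const_mul a (fun t => t) S.starProjection, cfc_id' ℝ S.starProjection]
  rw [CFC.rpow_eq_cfc_real (smul_nonneg hc (starProjection_nonneg S)), ← h1 c, ← h1 (c ^ s),
    ← cfc_comp' (fun t : ℝ => t ^ s) (fun t : ℝ => c * t) S.starProjection
      (Real.continuous_rpow_const hs.le).continuousOn]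
  refine cfc_congr fun t ht => ?_
  rcases S.isIdempotentElem_starProjection.spectrum_subset ℝ ht with rfl | rfl
  · simp [hs.ne']
  · simp

/-- For each `t ≥ 1` the operator `m ^ t P` is admissible in the maximum defining `Σ(S, A ^ t)`. As
`1 / t ≤ 1`, the root is operator monotone (Löwner–Heinz), so `m P` is a lower bound of the whole
family. -/
theorem smul_starProjection_le_spectralShorted (S : Submodule ℂ H) [CompleteSpace S]
    {A : H →L[ℂ] H} (hA : 0 ≤ A) {m : ℝ} (hm : 0 ≤ m)
    (h : S.starProjection ≤ spectralProjection A (Set.Ici m)) :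
    m • S.starProjection ≤ spectralShorted S A := by
  refine (spectralShorted_spec S A hA).1.2 ?_
  rintro _ ⟨t, ht, rfl⟩
  have ht0 : 0 < t := lt_of_lt_of_le one_pos ht
  have h1 : m ^ t • S.starProjection ≤ shorted S (A ^ t) := by
    refine (shorted_isGreatest S (A ^ t) CFC.rpow_nonneg).2 ⟨?_, ?_, ?_⟩
    · exact smul_nonneg (by positivity) (starProjection_nonneg S)
    · exact (smul_le_smul_of_nonneg_left h (by positivity)).trans
        (smul_spectralProjection_Ici_le_rpow hA hm ht0)
    · rintro _ ⟨x, rfl⟩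
      exact S.smul_of_tower_mem _ (Submodule.starProjection_apply_mem S x)
  have h2 := CFC.rpow_le_rpow (p := 1 / t) ⟨by positivity, (div_le_one ht0).2 ht⟩ h1
  rwa [smul_starProjection_rpow S (by positivity) (by positivity), ← Real.rpow_mul hm,
    mul_one_div_cancel ht0.ne', Real.rpow_one] at h2

/-! ### Consequences of a lower bound for the spectral shorted operator -/

theorem smul_starProjection_le_pow (S : Submodule ℂ H) [CompleteSpace S] {Z : H →L[ℂ] H} {c : ℝ}
    (hc : 0 ≤ c) (hZ : 0 ≤ Z) (hZS : Z.range ≤ S) (h : c • S.starProjection ≤ Z) (n : ℕ) :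
    c ^ (n + 1) • S.starProjection ≤ Z ^ (n + 1) := by
  set P := S.starProjection with hP
  have hPZ : P * Z = Z := by
    ext x
    exact Submodule.starProjection_eq_self_iff.2 (hZS ⟨x, rfl⟩)
  have hZP : Z * P = Z := by
    have h1 := congrArg star hPZ
    rwa [star_mul, (IsSelfAdjoint.of_nonneg hZ).star_eq,
      (IsSelfAdjoint.of_nonneg (starProjection_nonneg S)).star_eq] at h1
  -- Powers above `1` are not operator monotone in general; commutation of `Z` with `P` is what
  -- allows the inequality to be raised to a power.
  have hcomm : Commute Z P := hZP.trans hPZ.symm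
  induction n with
  | zero => simpa using h
  | succ n ih =>
    have h1 : 0 ≤ Z * (Z ^ (n + 1) - c ^ (n + 1) • P) :=
      Commute.mul_nonneg hZ (sub_nonneg.2 ih)
        (((Commute.refl Z).pow_right _).sub_right (hcomm.smul_right _))
    rw [mul_sub, mul_smul_comm, hZP, ← pow_succ', sub_nonneg] at h1
    refine le_trans ?_ h1
    rw [pow_succ, mul_smul]
    exact smul_le_smul_of_nonneg_left h (by positivity)

/-- The infimum `ρ` lies below `Σ(S, A ^ t) ^ (1 / t)` at `t = n + 1`. That root has range in `S`,
so it commutes with `P` and the power `n + 1` undoes the root. -/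
theorem smul_starProjection_le_pow_of_le_spectralShorted (S : Submodule ℂ H) [CompleteSpace S]
    {A : H →L[ℂ] H} (hA : 0 ≤ A) {c : ℝ} (hc : 0 ≤ c)
    (h : c • S.starProjection ≤ spectralShorted S A) (n : ℕ) :
    c ^ (n + 1) • S.starProjection ≤ A ^ (n + 1) := by
  have hn : (0 : ℝ) < ((n + 1 : ℕ) : ℝ) := by positivity
  have hn1 : (1 : ℝ) ≤ ((n + 1 : ℕ) : ℝ) := by simp
  obtain ⟨⟨h0, hle, hran⟩, -⟩ := shorted_isGreatest S (A ^ ((n + 1 : ℕ) : ℝ)) CFC.rpow_nonneg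
  have h1 := h.trans ((spectralShorted_spec S A hA).1.1 ⟨((n + 1 : ℕ) : ℝ), hn1, rfl⟩)
  have h2 := smul_starProjection_le_pow S hc CFC.rpow_nonneg
    (range_rpow_le h0 hran (one_div_pos.2 hn)) h1 n
  rw [← CFC.rpow_natCast _ (n + 1) CFC.rpow_nonneg,
    CFC.rpow_rpow_of_exponent_nonneg _ _ _ (one_div_pos.2 hn).le hn.le h0,
    one_div_mul_cancel hn.ne', CFC.rpow_one _ h0] at h2
  rw [CFC.rpow_natCast A (n + 1) hA] at hle h2
  exact h2.trans hle

/-- Comparing the two bounds at `y` gives `‖P y‖² ≤ (l / c) ^ (n + 1) b`, which tends to zero. -/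
theorem starProjection_eq_zero_of_pow_le {H : Type*} [NormedAddCommGroup H]
    [InnerProductSpace ℂ H] (S : Submodule ℂ H) [CompleteSpace S] {A : H →L[ℂ] H}
    {c l : ℝ} (hl : 0 ≤ l) (hlc : l < c)
    (h : ∀ n : ℕ, c ^ (n + 1) • S.starProjection ≤ A ^ (n + 1)) {y : H} {b : ℝ}
    (hy : ∀ n : ℕ, (⟪(A ^ (n + 1)) y, y⟫_ℂ).re ≤ l ^ (n + 1) * b) : S.starProjection y = 0 := by
  have hc : 0 < c := hl.trans_lt hlc
  have h1 : ∀ n : ℕ, ‖S.starProjection y‖ ^ 2 ≤ (l / c) ^ (n + 1) * b := by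
    intro n
    have h2 := (re_inner_le_of_le (h n) y).trans (hy n)
    rw [re_inner_smul_apply, re_inner_starProjection] at h2
    rw [div_pow, div_mul_eq_mul_div, le_div_iff₀ (by positivity), mul_comm]
    exact h2
  have h3 : Tendsto (fun n : ℕ => (l / c) ^ (n + 1) * b) atTop (𝓝 0) := by
    have h4 := (tendsto_pow_atTop_nhds_zero_of_lt_one (div_nonneg hl hc.le)
      ((div_lt_one hc).2 hlc)).comp (tendsto_add_atTop_nat 1)
    simpa using h4.mul_const b
  have h5 : ‖S.starProjection y‖ ^ 2 ≤ 0 := ge_of_tendsto' h3 h1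
  exact norm_eq_zero.1 (pow_eq_zero_iff two_ne_zero |>.1 (le_antisymm h5 (by positivity)))

theorem spectralMeasure_Iio_eq_zero_of_pow_le (S : Submodule ℂ H) [CompleteSpace S]
    {A : H →L[ℂ] H} (hA : 0 ≤ A) {c l : ℝ} (hl : 0 ≤ l) (hlc : l < c)
    (h : ∀ n : ℕ, c ^ (n + 1) • S.starProjection ≤ A ^ (n + 1)) {x : H} (hx : x ∈ S) :
    spectralMeasure A x (Set.Iio l) = 0 := by
  have hAs : IsSelfAdjoint A := .of_nonneg hA
  -- Positive exactly on `(-∞, l)`, so on the part of the spectrum where `f` lives `t ^ (n + 1)` is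
  -- at most `l ^ (n + 1)`.
  let f : BoundedContinuousFunction ℝ ℝ := BoundedContinuousFunction.ofNormedAddCommGroup
    (fun t => max 0 (min 1 (l - t))) (by fun_prop) 1 (fun t => by
      rw [Real.norm_of_nonneg (le_max_left _ _)]
      exact max_le zero_le_one (min_le_left _ _))
  have hf : ∀ t, f t = max 0 (min 1 (l - t)) := fun _ => rfl
  have hfc : ContinuousOn f (spectrum ℝ A) := f.continuous.continuousOn
  have hfs : IsSelfAdjoint (cfc f A) := cfc_predicate f A
  refine spectralMeasure_eq_zero_of_inner_cfc hAs f (fun t => le_max_left _ _) (fun t ht => ?_) ?_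
  · rw [hf]
    exact (lt_max_of_lt_right (lt_min one_pos (sub_pos.2 ht))).ne'
  · have h1 : S.starProjection (cfc f A x) = 0 := by
      refine starProjection_eq_zero_of_pow_le S hl hlc h
        (b := (⟪cfc f A (cfc f A x), x⟫_ℂ).re) fun n => ?_
      have h2 : cfc f A * (A ^ (n + 1) * cfc f A) ≤ l ^ (n + 1) • (cfc f A * cfc f A) := by
        rw [← cfc_pow_id (R := ℝ) A (n + 1), ← cfc_mul _ _ A (by fun_prop) hfc,
          ← cfc_mul _ _ A hfc (by fun_prop), ← cfc_mul _ _ A hfc hfc,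
          ← cfc_const_mul _ _ A (by fun_prop)]
        refine cfc_mono (fun t ht => ?_) (by fun_prop) (by fun_prop)
        have ht0 : 0 ≤ t := spectrum_nonneg_of_nonneg hA ht
        rcases le_total t l with htl | htl
        · have h3 : t ^ (n + 1) ≤ l ^ (n + 1) := by gcongr
          nlinarith [mul_le_mul_of_nonneg_right h3 (mul_self_nonneg (f t))]
        · have h4 : f t = 0 := by
            rw [hf]
            exact max_eq_left (min_le_of_right_le (sub_nonpos.2 htl))
          simp [h4]
      have h5 := re_inner_le_of_le h2 x
      rw [re_inner_smul_apply] at h5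
      simp only [mul_apply_eq_comp] at h5
      rwa [inner_left_eq_right hfs _ x] at h5
    -- For `x ∈ S`, `⟪f(A) x, x⟫ = ⟪f(A) x, P x⟫ = ⟪P f(A) x, x⟫ = 0`.
    rw [← Submodule.starProjection_eq_self_iff.2 hx,
      ← Submodule.inner_starProjection_left_eq_right, Submodule.starProjection_eq_self_iff.2 hx, h1,
      inner_zero_left]

/-! ### Compressions to the subspace -/

theorem smul_one_le_compression_iff (S : Submodule ℂ H) [CompleteSpace S] {T : H →L[ℂ] H}
    (hT : 0 ≤ T) (hTS : T.range ≤ S) (c : ℝ) :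
    algebraMap ℝ (S →L[ℂ] S) c ≤ compression S T ↔ c • S.starProjection ≤ T := by
  have hTs : IsSelfAdjoint T := .of_nonneg hT
  have hcomp : ∀ u v : S, ⟪compression S T u, v⟫_ℂ = ⟪T u, (v : H)⟫_ℂ := fun u v => by
    rw [Submodule.coe_inner, coe_compression S hTS]
  have hCs : IsSelfAdjoint (compression S T) := by
    rw [ContinuousLinearMap.isSelfAdjoint_iff_isSymmetric]
    intro u v
    change ⟪compression S T u, v⟫_ℂ = ⟪u, compression S T v⟫_ℂ
    rw [hcomp, ← inner_conj_symm u, hcomp, inner_conj_symm, inner_left_eq_right hTs]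
  -- A self-adjoint `T` with range in `S` satisfies `T = P T P`, so its form on `H` is determined by
  -- its form on `S`.
  have hP : ∀ x : H, (⟪T x, x⟫_ℂ).re = (⟪T (S.starProjection x), S.starProjection x⟫_ℂ).re := by
    intro x
    have h1 : S.starProjection (T x) = T x :=
      Submodule.starProjection_eq_self_iff.2 (hTS ⟨x, rfl⟩)
    have h2 : T (S.starProjection x) = T x := by
      refine ext_inner_right ℂ fun v => ?_
      have h3 : S.starProjection (T v) = T v :=
        Submodule.starProjection_eq_self_iff.2 (hTS ⟨v, rfl⟩)
      rw [inner_left_eq_right hTs, Submodule.inner_starProjection_left_eq_right, h3,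
        inner_left_eq_right hTs]
    rw [h2, ← Submodule.inner_starProjection_left_eq_right, h1]
  have hone : ∀ u : S, (⟪(algebraMap ℝ (S →L[ℂ] S) c) u, u⟫_ℂ).re = c * ‖(u : H)‖ ^ 2 := by
    intro u
    rw [Algebra.algebraMap_eq_smul_one, re_inner_smul_apply]
    congr 1
    exact inner_self_eq_norm_sq (𝕜 := ℂ) u
  constructor
  · intro h
    refine le_of_re_inner_le ((IsSelfAdjoint.all _).smul
      (.of_nonneg (starProjection_nonneg S))) hTs fun x => ?_
    have h1 := re_inner_le_of_le h ⟨_, Submodule.starProjection_apply_mem S x⟩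
    rw [hone, hcomp] at h1
    rw [re_inner_smul_apply, re_inner_starProjection, hP]
    exact h1
  · intro h
    refine le_of_re_inner_le ((IsSelfAdjoint.all _).algebraMap _) hCs fun u => ?_
    have h1 := re_inner_le_of_le h u
    rw [re_inner_smul_apply, re_inner_starProjection,
      Submodule.starProjection_eq_self_iff.2 u.2] at h1
    rw [hone, hcomp]
    exact h1

theorem spectralShorted_nonneg (S : Submodule ℂ H) [CompleteSpace S] {A : H →L[ℂ] H}
    (hA : 0 ≤ A) : 0 ≤ spectralShorted S A := by
  refine (spectralShorted_spec S A hA).1.2 ?_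
  rintro _ ⟨t, -, rfl⟩
  exact CFC.rpow_nonneg

theorem compression_nonneg (S : Submodule ℂ H) [CompleteSpace S] {T : H →L[ℂ] H}
    (hT : 0 ≤ T) (hTS : T.range ≤ S) : 0 ≤ compression S T := by
  have h := (smul_one_le_compression_iff S hT hTS 0).2 (by simpa using hT)
  simpa using h

/-! ### The four extrema -/

/-- Zero is admissible because the spectrum is nonnegative. An `l` beyond the top of the spectrum is
not, since then `μ_x = 0` for a nonzero `x ∈ S`, against `μ_x(ℝ) = ‖x‖²`. -/
theorem exists_isGreatest_starProjection_le (S : Submodule ℂ H) [CompleteSpace S] (hS : S ≠ ⊥)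
    {A : H →L[ℂ] H} (hA : 0 ≤ A) :
    ∃ m, IsGreatest {l : ℝ | 0 ≤ l ∧ S.starProjection ≤ spectralProjection A (Set.Ici l)} m := by
  have hAs : IsSelfAdjoint A := .of_nonneg hA
  obtain ⟨x, hx, hx0⟩ := S.ne_bot_iff.1 hS
  have : Nontrivial H := ⟨x, 0, hx0⟩
  simp_rw [starProjection_le_spectralProjection_iff S hAs]
  set L := {l : ℝ | 0 ≤ l ∧ ∀ x ∈ S, spectralMeasure A x (Set.Iio l) = 0} with hL
  have hne : L.Nonempty := ⟨0, le_rfl, fun y _ => measure_mono_null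
    (fun t ht hts => not_le_of_gt (Set.mem_Iio.1 ht) (spectrum_nonneg_of_nonneg hA hts))
    (spectralMeasure_compl_spectrum hAs y)⟩
  have hbdd : BddAbove L := by
    obtain ⟨M, hM⟩ := (spectrum.isCompact A).bddAbove (s := spectrum ℝ A)
    refine ⟨M, fun l hl => le_of_not_gt fun hMl => hx0 ?_⟩
    have h1 : spectralMeasure A x Set.univ = 0 := by
      refine measure_mono_null (fun t _ => ?_)
        (measure_union_null (hl.2 x hx) (spectralMeasure_compl_spectrum hAs x))
      by_cases ht : t ∈ spectrum ℝ A
      · exact Or.inl ((hM ht).trans_lt hMl)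
      · exact Or.inr ht
    have h2 := spectralMeasure_univ hAs x
    rw [measureReal_def, h1] at h2
    exact inner_self_eq_zero.1 (h2.symm.trans (by simp))
  refine ⟨sSup L, ⟨?_, fun y hy => measure_Iio_eq_zero_of_forall_lt fun l hl => ?_⟩,
    fun l hl => le_csSup hbdd hl⟩
  · obtain ⟨l, hl⟩ := hne
    exact hl.1.trans (le_csSup hbdd hl)
  · obtain ⟨k, hk, hlk⟩ := exists_lt_of_lt_csSup hne hl
    exact measure_mono_null (Set.Iio_subset_Iio hlk.le) (hk.2 y hy)

theorem exists_isLeast_spectrum [Nontrivial H] {T : H →L[ℂ] H} (hT : IsSelfAdjoint T) :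
    ∃ k, IsLeast (spectrum ℝ T) k ∧ ∀ c, algebraMap ℝ (H →L[ℂ] H) c ≤ T ↔ c ≤ k := by
  obtain ⟨k, hk⟩ := (spectrum.isCompact (𝕜 := ℝ) T).exists_isLeast
    (ContinuousFunctionalCalculus.spectrum_nonempty T hT)
  refine ⟨k, hk, fun c => ?_⟩
  rw [algebraMap_le_iff_le_spectrum hT]
  exact ⟨fun h => h k hk.1, fun h x hx => h.trans (hk.2 hx)⟩

theorem isLeast_spectrum_compression_spectralShorted (S : Submodule ℂ H) [CompleteSpace S]
    (hS : S ≠ ⊥) {A : H →L[ℂ] H} (hA : 0 ≤ A) {m : ℝ}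
    (hm : IsGreatest {l : ℝ | 0 ≤ l ∧ S.starProjection ≤ spectralProjection A (Set.Ici l)} m) :
    IsLeast (spectrum ℝ (compression S (spectralShorted S A))) m := by
  have hAs : IsSelfAdjoint A := .of_nonneg hA
  have h0 := spectralShorted_nonneg S hA
  have hran := range_spectralShorted_le S A hA
  have hCs : IsSelfAdjoint (compression S (spectralShorted S A)) :=
    .of_nonneg (compression_nonneg S h0 hran)
  have : Nontrivial S := Submodule.nontrivial_iff_ne_bot.2 hS
  obtain ⟨k, hk, hle⟩ := exists_isLeast_spectrum hCs
  simp_rw [smul_one_le_compression_iff S h0 hran] at hle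
  have hmk : m ≤ k := (hle m).1 (smul_starProjection_le_spectralShorted S hA hm.1.1 hm.1.2)
  have hk0 : 0 ≤ k := hm.1.1.trans hmk
  have hpow := smul_starProjection_le_pow_of_le_spectralShorted S hA hk0
    ((hle k).2 le_rfl)
  have hkm : k ≤ m := by
    -- The decay argument needs `l / k < 1`, so it is run for every `l < k`; negative `l` are
    -- covered by `m ≥ 0`.
    refine le_of_forall_lt_imp_le_of_dense fun l hl => ?_
    rcases lt_or_ge l 0 with hl0 | hl0
    · exact hl0.le.trans hm.1.1
    · exact hm.2 ⟨hl0, (starProjection_le_spectralProjection_iff S hAs l).2 fun x hx =>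
        spectralMeasure_Iio_eq_zero_of_pow_le S hA hl0 hl hpow hx⟩
  rwa [le_antisymm hmk hkm]

theorem isLeast_starProjection_mul_spectralProjection_ne_zero (S : Submodule ℂ H)
    [CompleteSpace S] (hS : S ≠ ⊥) {A : H →L[ℂ] H} (hA : 0 ≤ A) {m : ℝ}
    (hm : IsGreatest {l : ℝ | 0 ≤ l ∧ S.starProjection ≤ spectralProjection A (Set.Ici l)} m) :
    IsLeast {μ : ℝ | μ ∈ spectrum ℝ A ∧ ∀ ε : ℝ, 0 < ε →
      S.starProjection * spectralProjection A (Set.Ico μ (μ + ε)) ≠ 0} m := by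
  have hAs : IsSelfAdjoint A := .of_nonneg hA
  obtain ⟨z, -, hz0⟩ := S.ne_bot_iff.1 hS
  have : Nontrivial H := ⟨z, 0, hz0⟩
  simp_rw [starProjection_le_spectralProjection_iff S hAs] at hm
  simp_rw [ne_eq, starProjection_mul_spectralProjection_eq_zero_iff S hAs measurableSet_Ico]
  obtain ⟨⟨hm0, hmS⟩, hmax⟩ := hm
  -- If `[m, m + ε)` were null for all `x ∈ S`, so would be `(-∞, m + ε)`, making `m + ε`
  -- admissible.
  have key : ∀ ε : ℝ, 0 < ε → ¬ ∀ x ∈ S, spectralMeasure A x (Set.Ico m (m + ε)) = 0 := by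
    intro ε hε h
    have h1 : m + ε ≤ m := hmax ⟨by positivity, fun x hx => measure_mono_null
      (fun t ht => (lt_or_ge t m).imp id fun h2 => ⟨h2, ht⟩)
      (measure_union_null (hmS x hx) (h x hx))⟩
    linarith
  refine ⟨⟨?_, key⟩, ?_⟩
  -- Off the spectrum, a whole interval `[m, m + ε)` would miss it and hence be null, against `key`.
  · by_contra hms
    obtain ⟨ε, hε, hball⟩ := Metric.isOpen_iff.1
      (spectrum.isCompact (𝕜 := ℝ) A).isClosed.isOpen_compl m hms
    refine key ε hε fun x _ => measure_mono_null (fun t ht => hball ?_)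
      (spectralMeasure_compl_spectrum hAs x)
    rw [Metric.mem_ball, Real.dist_eq, abs_of_nonneg (sub_nonneg.2 ht.1)]
    linarith [ht.2]
  · rintro μ ⟨-, hμ⟩
    -- With `ε = m - μ` the interval is `[μ, m)`, which lies in the null set `(-∞, m)`.
    refine le_of_not_gt fun hlt => hμ (m - μ) (sub_pos.2 hlt) fun x hx => ?_
    exact measure_mono_null (fun t ht => by simpa using ht.2) (hmS x hx)

end SpectralShorted

theorem theorem4p9 {H : Type*} [NormedAddCommGroup H] [InnerProductSpace ℂ H] [CompleteSpace H]
    (S : Submodule ℂ H) [CompleteSpace S] (hS : S ≠ ⊥) (A : H →L[ℂ] H) (hA : 0 ≤ A) :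
    ∃ m : ℝ,
      IsLeast (spectrum ℝ
        (SpectralShorted.compression S (SpectralShorted.spectralShorted S A))) m ∧
      IsGreatest {l : ℝ | 0 ≤ l ∧
        S.starProjection ≤ SpectralShorted.spectralProjection A (Set.Ici l)} m ∧
      IsLeast {μ : ℝ | μ ∈ spectrum ℝ A ∧ ∀ ε : ℝ, 0 < ε →
        ¬ (SpectralShorted.spectralProjection A (Set.Ico μ (μ + ε))).range ≤ Sᗮ} m ∧
      IsLeast {μ : ℝ | μ ∈ spectrum ℝ A ∧ ∀ ε : ℝ, 0 < ε →
        S.starProjection * SpectralShorted.spectralProjection A (Set.Ico μ (μ + ε)) ≠ 0} m := by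
  obtain ⟨m, hm⟩ := SpectralShorted.exists_isGreatest_starProjection_le S hS hA
  have h := SpectralShorted.isLeast_starProjection_mul_spectralProjection_ne_zero S hS hA hm
  refine ⟨m, SpectralShorted.isLeast_spectrum_compression_spectralShorted S hS hA hm, hm, ?_, h⟩
  simpa only [SpectralShorted.range_le_orthogonal_iff] using h
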